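/- Let $X_t = x + pt - \sum_{i=1}^{N_t} U_i$ be the surplus process of the Cramér–Lundberg model: $N$ is a Poisson process with intensity $\beta>0$; the claim sizes $U_i\ge 0$ are i.i.d. with continuous distribution function and finite mean, and independent of $N$; and the premium rate satisfies $p>\beta\,\mathbb{E}(U_1)$. Let $(\mathcal F_t)_{t\ge 0}$ be the filtration generated by $X$ and the null events. Let $q>0$ be the discount rate and $\overline c>0$ the maximal dividend rate. For $x\ge 0$ and $c\in[0,\overline c]$ let $\Pi_{x,c,\overline c}$ be the set of all càdlàg, $(\mathcal F_t)$-adapted, non-decreasing processes $C=(C_t)_{t\ge 0}$ with $c\le C_t\le\overline c$ for all $t$. For such $C$ put $X^C_t = X_t-\int_0^t C_s\,ds$, $\tau=\inf\{t\ge 0: X^C_t<0\}$ (with $\inf\emptyset=\infty$), $J(x;C)=\mathbb{E}\big[\int_0^\tau e^{-qs}C_s\,ds\big]$, and define the optimal value function $$V(x,c)=\sup_{C\in\Pi_{x,c,\overline c}}J(x;C).$$ Then for every $c\in[0,\overline c]$, $$\lim_{x\to\infty}V(x,c)=\frac{\overline c}{q}.$$ -/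

import Mathlib

open MeasureTheory ProbabilityTheory Filter Set
open scoped NNReal ENNReal Topology

namespace Ratcheting

/-- `N` is a (homogeneous) Poisson process of intensity `β` on `(Ω, P)`: a counting process
started at `0`, with nondecreasing right-continuous paths and independent Poisson increments. -/
structure IsPoissonProcess {Ω : Type*} [MeasurableSpace Ω] (P : Measure Ω) (β : ℝ≥0)
    (N : ℝ≥0 → Ω → ℕ) : Prop where
  measurable : ∀ t, Measurable (N t)
  zero : ∀ ω, N 0 ω = 0
  mono : ∀ ω, Monotone fun t => N t ω
  rightCont : ∀ ω t, ContinuousWithinAt (fun s => N s ω) (Ici t) t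
  indepIncrements : HasIndepIncrements N P
  law_increment : ∀ s h : ℝ≥0,
    HasLaw (fun ω => N (s + h) ω - N s ω) (poissonMeasure (β * h)) P

/-- The Cramér–Lundberg model on the probability space `(Ω, P)`. The claim with index `i` (starting
from `0`) has size `U i`; `N t` is the number of claims up to time `t`. -/
structure CramerLundberg {Ω : Type*} [MeasurableSpace Ω] (P : Measure Ω) where
  /-- premium rate -/
  p : ℝ
  /-- claim intensity -/
  β : ℝ≥0
  /-- claim counting process -/
  N : ℝ≥0 → Ω → ℕ
  /-- claim sizes -/
  U : ℕ → Ω → ℝ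
  β_pos : 0 < β
  poisson : IsPoissonProcess P β N
  measurable_U : ∀ i, Measurable (U i)
  nonneg_U : ∀ i, ∀ᵐ ω ∂P, 0 ≤ U i ω
  iIndep_U : iIndepFun U P
  identDistrib_U : ∀ i, IdentDistrib (U i) (U 0) P P
  continuous_cdf_U : Continuous (cdf (P.map (U 0)))
  indep_N_U : IndepFun (fun ω t => N t ω) (fun ω i => U i ω) P
  integrable_U : Integrable (U 0) P
  /-- safety loading condition -/
  safety_loading : β * ∫ ω, U 0 ω ∂P < p

namespace CramerLundberg

variable {Ω : Type*} [MeasurableSpace Ω] {P : Measure Ω} (M : CramerLundberg P)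

/-- The free surplus `X t = x + p t - ∑_{i ≤ N t} U i`. -/
def X (x : ℝ) (t : ℝ≥0) (ω : Ω) : ℝ :=
  x + M.p * t - ∑ i ∈ Finset.range (M.N t ω), M.U i ω

theorem measurable_X (x : ℝ) (t : ℝ≥0) : Measurable (M.X x t) := by
  have h : Measurable fun a : ℕ × Ω => ∑ i ∈ Finset.range a.1, M.U i a.2 :=
    measurable_from_prod_countable_right fun n =>
      Finset.measurable_sum (Finset.range n) fun i _ => M.measurable_U i
  exact measurable_const.sub (h.comp ((M.poisson.measurable t).prodMk measurable_id))

/-- The filtration generated by the surplus process started at `x` and the `P`-null events. -/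
def filtration (x : ℝ) : Filtration ℝ≥0 ‹MeasurableSpace Ω› where
  seq t := (⨆ s ≤ t, MeasurableSpace.comap (M.X x s) inferInstance) ⊔
    MeasurableSpace.generateFrom {A | MeasurableSet A ∧ P A = 0}
  mono' _ _ hst := sup_le_sup_right (biSup_mono fun _ hr => le_trans hr hst) _
  le' _ := sup_le (iSup₂_le fun s _ => (M.measurable_X x s).comap_le)
    (MeasurableSpace.generateFrom_le fun _ hA => hA.1)

/-- `C` is an admissible dividend ratcheting strategy for initial surplus `x`, minimal initial
dividend rate `c` and maximal dividend rate `cbar`. -/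
structure Admissible (x c cbar : ℝ) (C : ℝ≥0 → Ω → ℝ) : Prop where
  adapted : Adapted (M.filtration x) C
  rightCont : ∀ ω t, ContinuousWithinAt (fun s => C s ω) (Ici t) t
  leftLim : ∀ ω t, ∃ l, Tendsto (fun s => C s ω) (𝓝[<] t) (𝓝 l)
  mono : ∀ ω, Monotone fun t => C t ω
  mem_Icc : ∀ ω t, C t ω ∈ Icc c cbar

/-- The controlled surplus `X t - ∫₀ᵗ C s ds`. -/
noncomputable def controlled (x : ℝ) (C : ℝ≥0 → Ω → ℝ) (t : ℝ≥0) (ω : Ω) : ℝ :=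
  M.X x t ω - ∫ s in (0 : ℝ)..t, C s.toNNReal ω

/-- The ruin time `inf {t ≥ 0 : controlled surplus at t is < 0}`, equal to `∞` without ruin. -/
noncomputable def ruinTime (x : ℝ) (C : ℝ≥0 → Ω → ℝ) (ω : Ω) : ℝ≥0∞ :=
  sInf ((fun t : ℝ≥0 => (t : ℝ≥0∞)) '' {t | M.controlled x C t ω < 0})

/-- The expected discounted dividends up to ruin, `E[∫₀^τ e^{-qs} C s ds]`. -/
noncomputable def J (q x : ℝ) (C : ℝ≥0 → Ω → ℝ) : ℝ :=
  ∫ ω, (∫ s in {s : ℝ | 0 ≤ s ∧ ENNReal.ofReal s < M.ruinTime x C ω},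
    Real.exp (-q * s) * C s.toNNReal ω) ∂P

/-- The optimal value function: the supremum of `J` over all admissible strategies. -/
noncomputable def V (q cbar x c : ℝ) : ℝ :=
  sSup {r | ∃ C, M.Admissible x c cbar C ∧ r = M.J q x C}

end CramerLundberg

end Ratcheting

namespace Ratcheting

/-! No strategy beats paying `cbar` forever, which is worth `cbar / q` (`J_le`). Conversely, paying
`cbar` from the start is admissible. On each path, claims up to a fixed date are finite, so ruin is
later than that date once `x` is large; two dominated convergences give value tending to `cbar / q`
(`tendsto_J_const`), and `V` is squeezed. -/

theorem integrableOn_exp_neg_mul {q : ℝ} (hq : 0 < q) (k : ℝ) :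
    IntegrableOn (fun s => Real.exp (-q * s) * k) (Ici (0 : ℝ)) := by
  rw [integrableOn_Ici_iff_integrableOn_Ioi]
  exact (integrableOn_exp_mul_Ioi (by linarith) 0).mul_const k

theorem integral_exp_neg_mul {q : ℝ} (hq : 0 < q) (k : ℝ) :
    ∫ s in Ici (0 : ℝ), Real.exp (-q * s) * k = k / q := by
  rw [integral_Ici_eq_integral_Ioi, integral_mul_const, integral_exp_mul_Ioi (by linarith)]
  simp
  field_simp

namespace CramerLundberg

variable {Ω : Type*} [MeasurableSpace Ω] {P : Measure Ω} (M : CramerLundberg P)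

theorem premium_pos : 0 < M.p :=
  (mul_nonneg M.β.2 (integral_nonneg_of_ae (M.nonneg_U 0))).trans_lt M.safety_loading

/-- Dividends paid up to ruin along a path are at most those of the maximal rate paid forever. -/
theorem discounted_dividends_le {q cbar : ℝ} (hq : 0 < q) (hcbar : 0 < cbar) {c x : ℝ}
    (hc : 0 ≤ c) {C : ℝ≥0 → Ω → ℝ} (hC : M.Admissible x c cbar C) (ω : Ω) :
    ∫ s in {s : ℝ | 0 ≤ s ∧ ENNReal.ofReal s < M.ruinTime x C ω},
      Real.exp (-q * s) * C s.toNNReal ω ≤ cbar / q := by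
  have hsub : {s : ℝ | 0 ≤ s ∧ ENNReal.ofReal s < M.ruinTime x C ω} ⊆ Ici 0 := fun s hs => hs.1
  have hI := integrableOn_exp_neg_mul hq cbar
  calc _ ≤ ∫ s in {s : ℝ | 0 ≤ s ∧ ENNReal.ofReal s < M.ruinTime x C ω},
        Real.exp (-q * s) * cbar := by
        refine integral_mono_of_nonneg (ae_of_all _ fun s => ?_) (hI.mono_set hsub)
          (ae_of_all _ fun s => ?_)
        · exact mul_nonneg (Real.exp_pos _).le (hc.trans (hC.mem_Icc ω _).1)
        · exact mul_le_mul_of_nonneg_left (hC.mem_Icc ω _).2 (Real.exp_pos _).le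
    _ ≤ ∫ s in Ici (0 : ℝ), Real.exp (-q * s) * cbar :=
        setIntegral_mono_set hI (ae_of_all _ fun s => by positivity) (ae_of_all _ hsub)
    _ = cbar / q := integral_exp_neg_mul hq cbar

/-- Integrability is needed only of the constant bound, so the ruin time of a general strategy need
not be shown measurable. -/
theorem J_le [IsProbabilityMeasure P] {q cbar : ℝ} (hq : 0 < q) (hcbar : 0 < cbar) {c x : ℝ}
    (hc : 0 ≤ c) {C : ℝ≥0 → Ω → ℝ} (hC : M.Admissible x c cbar C) :
    M.J q x C ≤ cbar / q := by
  have h := integral_mono_of_nonneg (μ := P) (g := fun _ => cbar / q)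
    (ae_of_all _ fun ω => ?_) (integrable_const _)
    (ae_of_all _ fun ω => M.discounted_dividends_le hq hcbar hc hC ω)
  · simpa [J] using h
  · exact integral_nonneg fun s => mul_nonneg (Real.exp_pos _).le (hc.trans (hC.mem_Icc ω _).1)

theorem admissible_const {c cbar : ℝ} (h : c ≤ cbar) (x : ℝ) :
    M.Admissible x c cbar fun _ _ => cbar where
  adapted _ := by fun_prop
  rightCont _ _ := continuousWithinAt_const
  leftLim _ _ := ⟨cbar, tendsto_const_nhds⟩
  mono _ := monotone_const
  mem_Icc _ _ := ⟨h, le_rfl⟩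

theorem controlled_const (x k : ℝ) (t : ℝ≥0) (ω : Ω) :
    M.controlled x (fun _ _ => k) t ω = M.X x t ω - t * k := by
  simp [controlled]

theorem measurable_controlled_const (x k : ℝ) (t : ℝ≥0) :
    Measurable (M.controlled x (fun _ _ => k) t) := by
  simp_rw [funext (M.controlled_const x k t)]
  exact (M.measurable_X x t).sub_const _

theorem continuousWithinAt_controlled_const (x k : ℝ) (t : ℝ≥0) (ω : Ω) :
    ContinuousWithinAt (fun s => M.controlled x (fun _ _ => k) s ω) (Ici t) t := by
  simp_rw [controlled_const, X]
  -- Any function on the discrete space `ℕ` is continuous, so the claim total inherits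
  -- right-continuity from `N`.
  have hS : ContinuousWithinAt (fun s => ∑ i ∈ Finset.range (M.N s ω), M.U i ω) (Ici t) t :=
    (continuous_of_discreteTopology (f := fun n : ℕ => ∑ i ∈ Finset.range n, M.U i ω)
      ).continuousAt.comp_continuousWithinAt (M.poisson.rightCont ω t)
  have hl : Continuous fun s : ℝ≥0 => x + M.p * s := by fun_prop
  have hk : Continuous fun s : ℝ≥0 => (s : ℝ) * k := by fun_prop
  exact (hl.continuousWithinAt.sub hS).sub hk.continuousWithinAt

theorem ruinTime_lt_iff {x : ℝ} {C : ℝ≥0 → Ω → ℝ} {ω : Ω} {a : ℝ≥0∞} :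
    M.ruinTime x C ω < a ↔ ∃ t : ℝ≥0, (t : ℝ≥0∞) < a ∧ M.controlled x C t ω < 0 := by
  rw [ruinTime, sInf_lt_iff]
  simp [and_comm]

/-- By right-continuity a negative surplus stays negative for a short while, so countably many dense
times detect ruin before `a`. -/
theorem measurable_ruinTime_const (x k : ℝ) : Measurable (M.ruinTime x fun _ _ => k) := by
  refine measurable_of_Iio fun a => ?_
  obtain ⟨D, hDc, hDd⟩ := TopologicalSpace.exists_countable_dense ℝ≥0
  have : M.ruinTime x (fun _ _ => k) ⁻¹' Iio a =
      ⋃ t ∈ D ∩ {t : ℝ≥0 | (t : ℝ≥0∞) < a}, {ω | M.controlled x (fun _ _ => k) t ω < 0} := by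
    ext ω
    simp only [mem_preimage, mem_Iio, ruinTime_lt_iff, mem_iUnion, mem_inter_iff, mem_ofPred_eq,
      exists_prop]
    constructor
    · rintro ⟨t, hta, ht⟩
      have h1 : ∀ᶠ s in 𝓝[>] t, M.controlled x (fun _ _ => k) s ω < 0 :=
        ((M.continuousWithinAt_controlled_const x k t ω).mono Ioi_subset_Ici_self).eventually
          (gt_mem_nhds ht)
      have h2 : ∀ᶠ s : ℝ≥0 in 𝓝[>] t, (s : ℝ≥0∞) < a :=
        nhdsWithin_le_nhds (ENNReal.continuous_coe.continuousAt.eventually (gt_mem_nhds hta))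
      obtain ⟨u, hu, hsub⟩ := mem_nhdsGT_iff_exists_Ioo_subset.1 (h1.and h2)
      obtain ⟨s, hs, hsu⟩ := hDd.exists_between hu
      exact ⟨s, ⟨hs, (hsub hsu).2⟩, (hsub hsu).1⟩
    · rintro ⟨t, ⟨_, hta⟩, ht⟩
      exact ⟨t, hta, ht⟩
  rw [this]
  exact MeasurableSet.biUnion (hDc.mono inter_subset_left) fun t _ =>
    measurableSet_lt (M.measurable_controlled_const x k t) measurable_const

/-- Moves the random horizon into the integrand, so that dominated convergence runs over a fixed
domain. -/
theorem setIntegral_before_ruin_eq (f : ℝ → ℝ) (τ : ℝ≥0∞) :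
    ∫ s in {s : ℝ | 0 ≤ s ∧ ENNReal.ofReal s < τ}, f s =
      ∫ s in Ici (0 : ℝ), {s : ℝ | ENNReal.ofReal s < τ}.indicator f s := by
  have h : MeasurableSet {s : ℝ | ENNReal.ofReal s < τ} :=
    measurableSet_lt ENNReal.measurable_ofReal measurable_const
  rw [setIntegral_indicator h]
  rfl

/-- Large initial surplus postpones ruin beyond any fixed date. -/
theorem eventually_lt_ruinTime_const {k : ℝ} (hk : 0 ≤ k) {ω : Ω} (hω : ∀ i, 0 ≤ M.U i ω)
    (s : ℝ) : ∀ᶠ x in atTop, ENNReal.ofReal s < M.ruinTime x (fun _ _ => k) ω := by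
  -- The extra `1` makes the final inequality strict. Up to `T`, the surplus loses at most `T * k`
  -- plus the claims up to `T`; premiums only help.
  set T : ℝ≥0 := s.toNNReal + 1
  filter_upwards [eventually_ge_atTop (T * k + ∑ i ∈ Finset.range (M.N T ω), M.U i ω)] with x hx
  refine lt_of_lt_of_le (b := (T : ℝ≥0∞)) ?_ (not_lt.1 fun h => ?_)
  · exact ENNReal.coe_lt_coe.2 (lt_add_one _)
  · obtain ⟨t, htT, ht⟩ := M.ruinTime_lt_iff.1 h
    have htT' : t ≤ T := (ENNReal.coe_lt_coe.1 htT).le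
    rw [controlled_const, X] at ht
    have h1 : ∑ i ∈ Finset.range (M.N t ω), M.U i ω ≤ ∑ i ∈ Finset.range (M.N T ω), M.U i ω :=
      Finset.sum_le_sum_of_subset_of_nonneg
        (Finset.range_subset_range.2 (M.poisson.mono ω htT')) fun i _ _ => hω i
    have h2 : (t : ℝ) * k ≤ T * k := mul_le_mul_of_nonneg_right (NNReal.coe_le_coe.2 htT') hk
    have h3 : 0 ≤ M.p * t := mul_nonneg M.premium_pos.le t.2
    linarith

theorem tendsto_J_const [IsProbabilityMeasure P] {q k : ℝ} (hq : 0 < q) (hk : 0 < k) :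
    Tendsto (fun x => M.J q x fun _ _ => k) atTop (𝓝 (k / q)) := by
  have hlim : ∫ _ : Ω, k / q ∂P = k / q := by simp
  rw [← hlim]
  refine tendsto_integral_filter_of_dominated_convergence (fun _ => k / q)
    (Eventually.of_forall fun x => ?_) (Eventually.of_forall fun x => ae_of_all _ fun ω => ?_)
    (integrable_const _) ?_
  · simp_rw [setIntegral_before_ruin_eq]
    refine (StronglyMeasurable.integral_prod_right (ν := volume.restrict (Ici (0 : ℝ)))
      (f := fun ω s => {s : ℝ | ENNReal.ofReal s < M.ruinTime x (fun _ _ => k) ω}.indicator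
        (fun s => Real.exp (-q * s) * k) s) ?_).aestronglyMeasurable
    have hset : MeasurableSet
        {z : Ω × ℝ | ENNReal.ofReal z.2 < M.ruinTime x (fun _ _ => k) z.1} :=
      measurableSet_lt (ENNReal.measurable_ofReal.comp measurable_snd)
        ((M.measurable_ruinTime_const x k).comp measurable_fst)
    have hf : Measurable fun z : Ω × ℝ => Real.exp (-q * z.2) * k := by fun_prop
    exact (hf.indicator hset).stronglyMeasurable
  · rw [Real.norm_of_nonneg (integral_nonneg fun s => by positivity)]
    exact M.discounted_dividends_le hq hk hk.le (M.admissible_const le_rfl x) ω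
  · filter_upwards [ae_all_iff.2 M.nonneg_U] with ω hω
    simp_rw [setIntegral_before_ruin_eq]
    rw [← integral_exp_neg_mul hq k]
    refine tendsto_integral_filter_of_dominated_convergence (fun s => Real.exp (-q * s) * k)
      (Eventually.of_forall fun x => ?_)
      (Eventually.of_forall fun x => ae_of_all _ fun s => ?_)
      (integrableOn_exp_neg_mul hq k) (ae_of_all _ fun s => ?_)
    · have hf : Measurable fun s : ℝ => Real.exp (-q * s) * k := by fun_prop
      exact (hf.indicator
        (measurableSet_lt ENNReal.measurable_ofReal measurable_const)).aestronglyMeasurable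
    · refine (norm_indicator_le_norm_self _ _).trans_eq (Real.norm_of_nonneg ?_)
      positivity
    -- For fixed `s` the integrand is eventually constant in `x`.
    · refine tendsto_const_nhds.congr' ?_
      filter_upwards [M.eventually_lt_ruinTime_const hk.le hω s] with x hx
      exact (indicator_of_mem (s := {s : ℝ | ENNReal.ofReal s < M.ruinTime x (fun _ _ => k) ω}) hx
        fun s => Real.exp (-q * s) * k).symm

end CramerLundberg

end Ratcheting

theorem mainTheorem11 {Ω : Type*} [MeasurableSpace Ω] (P : Measure Ω) [IsProbabilityMeasure P]
    (M : Ratcheting.CramerLundberg P) (q cbar : ℝ) (hq : 0 < q) (hcbar : 0 < cbar) :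
    ∀ c ∈ Icc (0 : ℝ) cbar,
      Tendsto (fun x => M.V q cbar x c) atTop (𝓝 (cbar / q)) := by
  intro c hc
  have hle : ∀ x, cbar / q ∈ upperBounds {r | ∃ C, M.Admissible x c cbar C ∧ r = M.J q x C} := by
    rintro x _ ⟨C, hC, rfl⟩
    exact M.J_le hq hcbar hc.1 hC
  have hmem : ∀ x, M.J q x (fun _ _ => cbar) ∈
      {r | ∃ C, M.Admissible x c cbar C ∧ r = M.J q x C} :=
    fun x => ⟨_, M.admissible_const hc.2 x, rfl⟩
  -- The real `sSup` is meaningful here: the set is bounded above by `hle` and nonempty by `hmem`.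
  exact tendsto_of_tendsto_of_tendsto_of_le_of_le (M.tendsto_J_const hq hcbar) tendsto_const_nhds
    (fun x => le_csSup ⟨_, hle x⟩ (hmem x)) fun x => csSup_le ⟨_, hmem x⟩ (hle x)
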